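/- Let $m\geq 2$ and let $\mathbb{R}_m=C\ell_{0,m}$ be the real Clifford algebra with generators $e_1,\dots,e_m$, $e_j^2=-1$, $e_je_k=-e_ke_j$ for $j\neq k$. Identify $\mathbb{R}^{m+1}$ with the space of paravectors $x=x_0+\sum_{j=1}^m x_je_j$; put $\mathrm{Im}(x)=\sum_{j=1}^m x_je_j$, $|\mathrm{Im}(x)|^2=\sum_{j=1}^m x_j^2$, $\overline{x}=x_0-\mathrm{Im}(x)$, and let $\mathbb{S}^{m-1}=\{I\in\mathbb{R}^{m+1}: I^2=-1\}=\{I: I_0=0,\ |\mathrm{Im}(I)|=1\}$. Let $\Omega\subseteq\mathbb{R}^{m+1}$ be a connected open set with $\Omega\cap\mathbb{R}\neq\emptyset$ that is circular, i.e. $\Omega=\{\alpha+I\beta:\ \alpha+i\beta\in E,\ I\in\mathbb{S}^{m-1}\}$ for some $E\subseteq\mathbb{C}$. Let $D=\{\alpha+i\beta\in\mathbb{C}:\ \alpha+I\beta\in\Omega\text{ for some } I\in\mathbb{S}^{m-1}\}$ (the conjugation-invariant open set whose circularization is $\Omega$) and let $\Omega_*=\Omega\setminus\mathbb{R}$. A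 function $f:\Omega\to\mathbb{R}_m$ is *slice monogenic* if it is of class $C^1$ on $\Omega$ and $\frac12\left(\frac{\partial}{\partial\alpha}+I\frac{\partial}{\partial\beta}\right)f(\alpha+I\beta)=0$ for all $\alpha+i\beta\in D$ and $I\in\mathbb{S}^{m-1}$. It is *global slice polymonogenic of order $n$* if there are slice monogenic functions $f_0,\dots,f_{n-1}:\Omega\to\mathbb{R}_m$ with $f(x)=\sum_{h=0}^{n-1}\overline{x}^{\,h}f_h(x)$ for all $x\in\Omega$; let $\mathcal{SM}^n(\Omega,\mathbb{R}_m)$ be the set of these functions. Let $\mathcal{S}^n(\Omega,\mathbb{R}_m)$ be the set of functions $f:\Omega\to\mathbb{R}_m$ for which there are functions $F_1,F_2:D\to\mathbb{R}_m$ of class $C^n$ with $F_1(\overline z)=F_1(z)$ and $F_2(\overline z)=-F_2(z)$ on $D$ (a $C^n$ stem function $F_1+iF_2$) such that $f(\alpha+I\beta)=F_1(\alpha+i\beta)+IF_2(\alpha+i\beta)$ for all $\alpha+i\beta\in D$ and $I\in\mathbb{S}^{m-1}$. Let $f_*=f|_{\Omega_*}$, and let $$\overline{\vartheta}_m=\frac12\left(\frac{\partial}{\partial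 x_0}+\frac{\mathrm{Im}(x)}{|\mathrm{Im}(x)|^2}\sum_{h=1}^m x_h\frac{\partial}{\partial x_h}\right),\qquad \overline{\vartheta}_m^{\,n}:C^n(\Omega_*,\mathbb{R}_m)\to C^0(\Omega_*,\mathbb{R}_m).$$ Then, for every integer $n\geq 1$, $$\mathcal{SM}^n(\Omega,\mathbb{R}_m)=\{f\in\mathcal{S}^n(\Omega,\mathbb{R}_m): f_*\in C^n(\Omega_*,\mathbb{R}_m)\text{ and } \overline{\vartheta}_m^{\,n}f_*=0 \text{ on }\Omega_*\},$$ and every function in $\mathcal{SM}^n(\Omega,\mathbb{R}_m)$ is real analytic on $\Omega$. -/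

import Mathlib

noncomputable section

namespace SliceMonogenic

/-- The negative definite quadratic form `v ↦ -(v₁² + … + v_m²)` on `ℝ^m`. -/
def negForm (m : ℕ) : QuadraticForm ℝ (Fin m → ℝ) :=
  QuadraticMap.weightedSumSquares ℝ (fun _ : Fin m => (-1 : ℝ))

/-- The real Clifford algebra `ℝ_m = Cℓ_{0,m}`, generated by anticommuting `e₁, …, e_m` with
`e_j² = -1`. -/
abbrev Cl (m : ℕ) : Type := CliffordAlgebra (negForm m)

theorem finite_exteriorAlgebra (m : ℕ) :
    Module.Finite ℝ (ExteriorAlgebra ℝ (Fin m → ℝ)) := by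
  have hbot : ∀ i : ℕ, m < i → (⋀[ℝ]^i (Fin m → ℝ)) = ⊥ := by
    intro i hi
    rw [← Submodule.finrank_eq_zero (R := ℝ), exteriorPower.finrank_eq]
    simpa using Nat.choose_eq_zero_of_lt hi
  have htop : (⨆ i : ℕ, (⋀[ℝ]^i (Fin m → ℝ))) = ⊤ :=
    (DirectSum.Decomposition.isInternal
      (fun i : ℕ => ⋀[ℝ]^i (Fin m → ℝ))).submodule_iSup_eq_top
  rw [Module.finite_def, ← htop]
  have h : (⨆ i : ℕ, (⋀[ℝ]^i (Fin m → ℝ))) =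
      ⨆ i : Fin (m + 1), (⋀[ℝ]^(i : ℕ) (Fin m → ℝ)) := by
    apply le_antisymm
    · refine iSup_le fun i => ?_
      by_cases hi : i < m + 1
      · exact le_iSup (fun i : Fin (m + 1) => (⋀[ℝ]^(i : ℕ) (Fin m → ℝ))) ⟨i, hi⟩
      · rw [hbot i (by omega)]
        exact bot_le
    · exact iSup_le fun i => le_iSup (fun i : ℕ => (⋀[ℝ]^i (Fin m → ℝ))) (i : ℕ)
  rw [h]
  exact Submodule.fg_iSup _ fun i => Module.Finite.iff_fg.mp inferInstance

/-- `ℝ_m` is finite dimensional. -/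
instance instFiniteCl (m : ℕ) : Module.Finite ℝ (Cl m) := by
  have := finite_exteriorAlgebra m
  have : Invertible (2 : ℝ) := invertibleOfNonzero two_ne_zero
  exact Module.Finite.equiv (CliffordAlgebra.equivExterior (negForm m)).symm

/-- A norm on the finite-dimensional real vector space `ℝ_m`, the sup norm of the coordinates in a
basis.  All norms on `ℝ_m` are equivalent, so continuity, smoothness and analyticity of maps into
`ℝ_m` do not depend on the choice. -/
instance instNormedAddCommGroupCl (m : ℕ) : NormedAddCommGroup (Cl m) :=
  NormedAddCommGroup.induced (Cl m) (Fin (Module.finrank ℝ (Cl m)) → ℝ)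
    (Module.finBasis ℝ (Cl m)).equivFun (Module.finBasis ℝ (Cl m)).equivFun.injective

instance instNormedSpaceCl (m : ℕ) : NormedSpace ℝ (Cl m) :=
  NormedSpace.induced ℝ (Cl m) (Fin (Module.finrank ℝ (Cl m)) → ℝ)
    (Module.finBasis ℝ (Cl m)).equivFun

/-- The generators `e₁, …, e_m` of `ℝ_m` (indexed from `0`). -/
def gen (m : ℕ) (j : Fin m) : Cl m := CliffordAlgebra.ι (negForm m) (Pi.single j 1)

/-- `ℝ^{m+1}`, with coordinates `(x₀, x₁, …, x_m)`. -/
abbrev Para (m : ℕ) : Type := EuclideanSpace ℝ (Fin (m + 1))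

/-- The imaginary part `∑ x_j e_j ∈ ℝ_m` of the paravector `x`. -/
def imCl {m : ℕ} (x : Para m) : Cl m := ∑ j : Fin m, x j.succ • gen m j

/-- `|Im x|² = ∑ x_j²`. -/
def imNormSq {m : ℕ} (x : Para m) : ℝ := ∑ j : Fin m, x j.succ ^ 2

/-- The paravector `x₀ + ∑ x_j e_j`, as an element of `ℝ_m`. -/
def toCl {m : ℕ} (x : Para m) : Cl m := algebraMap ℝ (Cl m) (x 0) + imCl x

/-- The conjugate paravector `x₀ - ∑ x_j e_j`, as an element of `ℝ_m`. -/
def conjCl {m : ℕ} (x : Para m) : Cl m := algebraMap ℝ (Cl m) (x 0) - imCl x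

/-- The sphere `S^{m-1}` of paravector imaginary units: `Re I = 0` and `|Im I| = 1`.  See
`mem_imUnits_iff` for the description `I² = -1`. -/
def imUnits (m : ℕ) : Set (Para m) := {I | I 0 = 0 ∧ imNormSq I = 1}

theorem imCl_mul_self {m : ℕ} (x : Para m) :
    imCl x * imCl x = algebraMap ℝ (Cl m) (-imNormSq x) := by
  have h : imCl x = CliffordAlgebra.ι (negForm m) (fun j => x j.succ) := by
    unfold imCl gen
    simp only [← map_smul, ← map_sum]
    congr 1
    ext k
    simp [Finset.sum_apply, Pi.single_apply]
  rw [h, CliffordAlgebra.ι_sq_scalar]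
  congr 1
  simp [negForm, QuadraticMap.weightedSumSquares_apply, imNormSq, sq]

theorem mem_imUnits_iff {m : ℕ} (x : Para m) : x ∈ imUnits m ↔ toCl x ^ 2 = -1 := by
  have hinj : Function.Injective (algebraMap ℝ (Cl m)) :=
    (algebraMap ℝ (Cl m)).injective
  have hsq := imCl_mul_self x
  have hcomm : algebraMap ℝ (Cl m) (x 0) * imCl x = imCl x * algebraMap ℝ (Cl m) (x 0) :=
    Algebra.commutes _ _
  constructor
  · rintro ⟨h0, h1⟩
    simp [toCl, h0, sq, hsq, h1]
  · intro h
    have hinv : CliffordAlgebra.involute (imCl x) = -imCl x := by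
      simp [imCl, gen]
    have e1 : algebraMap ℝ (Cl m) (x 0 ^ 2 - imNormSq x + 1) +
        (2 * x 0) • imCl x = 0 := by
      have : toCl x ^ 2 = algebraMap ℝ (Cl m) (x 0 ^ 2 - imNormSq x) + (2 * x 0) • imCl x := by
        rw [toCl, sq, add_mul, mul_add, mul_add, hsq, ← hcomm, ← map_mul, Algebra.smul_def]
        simp only [map_sub, map_neg, map_mul, map_pow, map_ofNat]
        noncomm_ring
      rw [this] at h
      rw [map_add, map_one, add_right_comm, h]
      simp
    have e2 := congrArg CliffordAlgebra.involute e1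
    rw [map_add, map_smul, hinv, AlgHom.commutes, map_zero] at e2
    have e3 : algebraMap ℝ (Cl m) (x 0 ^ 2 - imNormSq x + 1) = 0 := by
      have e5 : (2 : ℝ) • algebraMap ℝ (Cl m) (x 0 ^ 2 - imNormSq x + 1) = 0 := by
        have := congrArg₂ (· + ·) e1 e2
        simp only [smul_neg, add_zero] at this
        rw [two_smul, ← this]
        abel
      exact (smul_eq_zero.mp e5).resolve_left two_ne_zero
    rw [e3, zero_add] at e1
    have r1 : x 0 ^ 2 - imNormSq x + 1 = 0 := hinj (by rw [e3, map_zero])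
    have hx0 : x 0 = 0 := by
      rcases smul_eq_zero.mp e1 with h2 | h2
      · linarith
      · rw [h2, mul_zero] at hsq
        have : -imNormSq x = 0 := hinj (by rw [← hsq, map_zero])
        nlinarith [sq_nonneg (x 0)]
    refine ⟨hx0, ?_⟩
    rw [hx0] at r1
    linarith

/-- The map `φ_I : α + iβ ↦ α + Iβ`. -/
def phi {m : ℕ} (I : Para m) (z : ℂ) : Para m :=
  z.re • EuclideanSpace.single 0 1 + z.im • I

/-- The circularization `{α + Iβ : α + iβ ∈ E, I ∈ S^{m-1}}` of `E ⊆ ℂ` in `ℝ^{m+1}`. -/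
def circularization (m : ℕ) (E : Set ℂ) : Set (Para m) :=
  {x | ∃ z ∈ E, ∃ I ∈ imUnits m, x = phi I z}

/-- Circular (axially symmetric) subsets of `ℝ^{m+1}`. -/
def IsCircular {m : ℕ} (Ω : Set (Para m)) : Prop := ∃ E : Set ℂ, Ω = circularization m E

/-- The conjugation invariant set `D ⊆ ℂ` whose circularization is the circular set `Ω`. -/
def planar {m : ℕ} (Ω : Set (Para m)) : Set ℂ := {z | ∃ I ∈ imUnits m, phi I z ∈ Ω}

theorem neg_mem_imUnits {m : ℕ} {I : Para m} (hI : I ∈ imUnits m) : -I ∈ imUnits m := by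
  obtain ⟨h0, h1⟩ := hI
  exact ⟨by simp [h0], by simpa [imNormSq] using h1⟩

theorem phi_neg_conj {m : ℕ} (I : Para m) (z : ℂ) :
    phi (-I) ((starRingEnd ℂ) z) = phi I z := by
  simp [phi]

theorem conj_mem_planar {m : ℕ} {Ω : Set (Para m)} {z : ℂ} (hz : z ∈ planar Ω) :
    (starRingEnd ℂ) z ∈ planar Ω := by
  obtain ⟨I, hI, h⟩ := hz
  exact ⟨-I, neg_mem_imUnits hI, by rwa [phi_neg_conj]⟩

theorem phi_eq_phi {m : ℕ} {I J : Para m} (hI : I ∈ imUnits m) (hJ : J ∈ imUnits m) {z w : ℂ}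
    (h : phi I z = phi J w) : w = z ∨ w = (starRingEnd ℂ) z := by
  have hre : z.re = w.re := by
    have := congrArg (fun x : Para m => x 0) h
    simpa [phi, hI.1, hJ.1] using this
  have him : z.im ^ 2 = w.im ^ 2 := by
    have key : ∀ (K : Para m) (u : ℂ), K ∈ imUnits m → imNormSq (phi K u) = u.im ^ 2 := by
      intro K u hK
      have h1 : imNormSq K = 1 := hK.2
      unfold imNormSq at h1
      simp [imNormSq, phi, mul_pow, ← Finset.mul_sum, h1]
    rw [← key I z hI, ← key J w hJ, h]
  rcases sq_eq_sq_iff_eq_or_eq_neg.mp him with h1 | h1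
  · exact Or.inl (Complex.ext hre.symm h1.symm)
  · refine Or.inr (Complex.ext ?_ ?_)
    · simp [hre]
    · simp [h1]

/-- A circular set is the circularization of its planar domain. -/
theorem circularization_planar {m : ℕ} {Ω : Set (Para m)} (hΩ : IsCircular Ω) :
    circularization m (planar Ω) = Ω := by
  obtain ⟨E, rfl⟩ := hΩ
  ext x
  constructor
  · rintro ⟨z, ⟨J, hJ, w, hw, K, hK, hzw⟩, I, hI, rfl⟩
    rcases phi_eq_phi hJ hK hzw with h | h
    · exact ⟨w, hw, I, hI, by rw [h]⟩
    · exact ⟨w, hw, -I, neg_mem_imUnits hI, by rw [h, phi_neg_conj]⟩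
  · rintro ⟨z, hz, I, hI, rfl⟩
    exact ⟨z, ⟨I, hI, z, hz, I, hI, rfl⟩, I, hI, rfl⟩

/-- `∂̄_I f`, read on `D` through `φ_I`:
`z ↦ ½ (∂/∂α + I ∂/∂β)(f ∘ φ_I)(z)`. -/
def dbar {m : ℕ} (I : Para m) (f : Para m → Cl m) (z : ℂ) : Cl m :=
  (1 / 2 : ℝ) • (fderiv ℝ (fun w => f (phi I w)) z 1 +
    toCl I * fderiv ℝ (fun w => f (phi I w)) z Complex.I)

/-- Slice monogenic functions on `Ω`. -/
def sliceMonogenic {m : ℕ} (Ω : Set (Para m)) : Set (Para m → Cl m) :=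
  {f | ContDiffOn ℝ 1 f Ω ∧ ∀ I ∈ imUnits m, ∀ z ∈ planar Ω, dbar I f z = 0}

/-- Global slice polymonogenic functions of order `n` on `Ω`. -/
def globalSlicePolymonogenic {m : ℕ} (n : ℕ) (Ω : Set (Para m)) : Set (Para m → Cl m) :=
  {f | ∃ g : Fin n → Para m → Cl m, (∀ h, g h ∈ sliceMonogenic Ω) ∧
    ∀ x ∈ Ω, f x = ∑ h : Fin n, conjCl x ^ (h : ℕ) * g h x}

/-- `F = F₁ + i F₂ : D → ℝ_m ⊗ ℂ` is a stem function. -/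
def IsStem {m : ℕ} (D : Set ℂ) (F₁ F₂ : ℂ → Cl m) : Prop :=
  ∀ z ∈ D, F₁ ((starRingEnd ℂ) z) = F₁ z ∧ F₂ ((starRingEnd ℂ) z) = -F₂ z

/-- `𝒮ⁿ(Ω, ℝ_m)`: the slice functions on `Ω` induced by stem functions of class `Cⁿ`. -/
def sliceFunctions {m : ℕ} (n : ℕ) (Ω : Set (Para m)) : Set (Para m → Cl m) :=
  {f | ∃ F₁ F₂ : ℂ → Cl m, IsStem (planar Ω) F₁ F₂ ∧
    ContDiffOn ℝ n F₁ (planar Ω) ∧ ContDiffOn ℝ n F₂ (planar Ω) ∧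
    ∀ z ∈ planar Ω, ∀ I ∈ imUnits m, f (phi I z) = F₁ z + toCl I * F₂ z}

/-- The real axis in `ℝ^{m+1}`. -/
def realAxis (m : ℕ) : Set (Para m) := {x | ∀ j : Fin m, x j.succ = 0}

/-- The partial derivative `∂g/∂x_h`. -/
def partialDeriv {m : ℕ} (h : Fin (m + 1)) (g : Para m → Cl m) (x : Para m) : Cl m :=
  fderiv ℝ g x (EuclideanSpace.single h 1)

/-- The operator
`ϑ̄_m = ½ (∂/∂x₀ + Im(x)/|Im(x)|² (∑ x_h ∂/∂x_h))`, considered off the real axis. -/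
def thetaBar {m : ℕ} (g : Para m → Cl m) (x : Para m) : Cl m :=
  (1 / 2 : ℝ) • (partialDeriv 0 g x +
    ((imNormSq x)⁻¹ • imCl x) * ∑ j : Fin m, x j.succ • partialDeriv j.succ g x)

/-- The kernel of `ϑ̄_mⁿ : Cⁿ(U, ℝ_m) → C⁰(U, ℝ_m)`, for an open set `U` off the real axis. -/
def kerThetaBarPow {m : ℕ} (n : ℕ) (U : Set (Para m)) : Set (Para m → Cl m) :=
  {g | ContDiffOn ℝ n g U ∧ ∀ x ∈ U, (thetaBar^[n] g) x = 0}

end SliceMonogenic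

end

/-! Everything is transported to the planar domain `D`. A slice function is `sliceMap I ∘ F` on each
slice, where `F : D → ℝ_m ⊗ ℂ` is a stem function and `sliceMap I` sends `a + ib` to `a + Ib`. Since
`sliceMap I` turns multiplication by `i` into left multiplication by `I`, it carries `∂̄F` to `∂̄_I
f` (`dbar_eq_sliceMap`) and `z̄^h` to `x̄^h`. Off the real axis `ϑ̄_m` restricts to `∂̄_I` on every
slice (`thetaBar_phi`), so `ϑ̄_mⁿ f` is induced by `∂̄ⁿ F` (`thetaBar_iterate_phi`).

If `ϑ̄_mⁿ f = 0`, then `∂̄ⁿ F` vanishes off `ℝ`, hence on `D` by continuity. So `F` is polyanalytic,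
`F = ∑ z̄^h G_h` with holomorphic `G_h` (`exists_eq_conjPolySum`). The `G_h` can be symmetrized into
stem functions, and these induce the slice monogenic coefficients of `f`.

Conversely, a slice monogenic function comes from a holomorphic stem function
(`exists_stem_of_mem_sliceMonogenic`): by the identity theorem on the connected set `D`, it is
determined by its values on `Ω ∩ ℝ`. Then `∂̄ⁿ` kills `∑_{h<n} z̄^h G_h`.

Analyticity (`analyticOnNhd_of_stem`) is a composition of analytic maps off the real axis; at a real
point, `f` is a power series in the paravector with coefficients in `ℝ_m`. -/

noncomputable section

namespace SliceMonogenic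

/-! ### The complexified Clifford algebra and evaluation on slices -/

/-- The space `ℝ_m ⊗ ℂ` of values of stem functions, in coordinates. -/
abbrev StemSpace (m : ℕ) : Type := Fin (Module.finrank ℝ (Cl m)) → ℂ

/-- The real part `ℝ_m ⊗ ℂ → ℝ_m`. -/
def reL (m : ℕ) : StemSpace m →L[ℝ] Cl m :=
  LinearMap.toContinuousLinearMap
    ((Module.finBasis ℝ (Cl m)).equivFun.symm.toLinearMap ∘ₗ
      LinearMap.pi fun j => Complex.reLm ∘ₗ LinearMap.proj j)

/-- The imaginary part `ℝ_m ⊗ ℂ → ℝ_m`. -/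
def imL (m : ℕ) : StemSpace m →L[ℝ] Cl m :=
  LinearMap.toContinuousLinearMap
    ((Module.finBasis ℝ (Cl m)).equivFun.symm.toLinearMap ∘ₗ
      LinearMap.pi fun j => Complex.imLm ∘ₗ LinearMap.proj j)

/-- The inclusion `ℝ_m → ℝ_m ⊗ ℂ`. -/
def complexify (m : ℕ) : Cl m →L[ℝ] StemSpace m :=
  LinearMap.toContinuousLinearMap
    ((LinearMap.pi fun j => Complex.ofRealCLM.toLinearMap ∘ₗ LinearMap.proj j) ∘ₗ
      (Module.finBasis ℝ (Cl m)).equivFun.toLinearMap)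

/-- Multiplication of `ℝ_m` as a continuous bilinear map. -/
def mulL (m : ℕ) : Cl m →L[ℝ] Cl m →L[ℝ] Cl m :=
  LinearMap.toContinuousLinearMap
    (LinearMap.toContinuousLinearMap.toLinearMap ∘ₗ LinearMap.mul ℝ (Cl m))

variable {m : ℕ}

@[simp] theorem mulL_apply (a b : Cl m) : mulL m a b = a * b := rfl

theorem reL_apply (w : StemSpace m) :
    reL m w = (Module.finBasis ℝ (Cl m)).equivFun.symm fun j => (w j).re := rfl

theorem imL_apply (w : StemSpace m) :
    imL m w = (Module.finBasis ℝ (Cl m)).equivFun.symm fun j => (w j).im := rfl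

theorem complexify_apply (v : Cl m) :
    complexify m v = fun j => (((Module.finBasis ℝ (Cl m)).equivFun v j : ℝ) : ℂ) := rfl

@[simp] theorem reL_complexify (v : Cl m) : reL m (complexify m v) = v := by
  simp only [reL_apply, complexify_apply, Complex.ofReal_re, LinearEquiv.symm_apply_apply]

@[simp] theorem imL_complexify (v : Cl m) : imL m (complexify m v) = 0 := by
  simp only [imL_apply, complexify_apply, Complex.ofReal_im]
  exact map_zero _

@[simp] theorem reL_I_smul (w : StemSpace m) : reL m (Complex.I • w) = -imL m w := by
  rw [reL_apply, imL_apply, ← map_neg]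
  congr 1
  ext j
  simp

@[simp] theorem imL_I_smul (w : StemSpace m) : imL m (Complex.I • w) = reL m w := by
  rw [reL_apply, imL_apply]
  congr 1
  ext j
  simp

@[simp] theorem reL_star (w : StemSpace m) : reL m (star w) = reL m w := by
  simp [reL_apply]

@[simp] theorem imL_star (w : StemSpace m) : imL m (star w) = -imL m w := by
  rw [imL_apply, imL_apply, ← map_neg]
  congr 1

theorem star_complexify (v : Cl m) : star (complexify m v) = complexify m v := by
  ext j
  simp [complexify_apply]

theorem complexify_re_add_im (w : StemSpace m) :
    complexify m (reL m w) + Complex.I • complexify m (imL m w) = w := by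
  ext j
  simp only [complexify_apply, reL_apply, imL_apply, LinearEquiv.apply_symm_apply, Pi.add_apply,
    Pi.smul_apply, smul_eq_mul]
  rw [mul_comm, Complex.re_add_im]

/-- Evaluation of stem values on the slice of the imaginary unit `I`: `a + i b ↦ a + I b`. -/
def sliceMap (I : Para m) : StemSpace m →L[ℝ] Cl m := reL m + mulL m (toCl I) ∘L imL m

/-- A right inverse of `sliceMap I` that intertwines left multiplication by `I` with `i`. -/
def unslice (I : Para m) : Cl m →L[ℝ] StemSpace m :=
  (1 / 2 : ℝ) • (complexify m - Complex.I • (complexify m ∘L mulL m (toCl I)))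

theorem sliceMap_apply (I : Para m) (w : StemSpace m) :
    sliceMap I w = reL m w + toCl I * imL m w := rfl

theorem unslice_apply (I : Para m) (v : Cl m) :
    unslice I v = (1 / 2 : ℝ) • (complexify m v - Complex.I • complexify m (toCl I * v)) := rfl

theorem toCl_eq_imCl {I : Para m} (hI : I ∈ imUnits m) : toCl I = imCl I := by
  simp [toCl, hI.1]

theorem toCl_mul_self {I : Para m} (hI : I ∈ imUnits m) : toCl I * toCl I = -1 := by
  rw [← sq]
  exact (mem_imUnits_iff I).1 hI

theorem toCl_mul_toCl_mul {I : Para m} (hI : I ∈ imUnits m) (v : Cl m) :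
    toCl I * (toCl I * v) = -v := by
  rw [← mul_assoc, toCl_mul_self hI, neg_one_mul]

theorem toCl_neg {I : Para m} : toCl (-I) = -toCl I := by
  simp [toCl, imCl, Finset.sum_neg_distrib]
  abel

theorem sliceMap_I_smul {I : Para m} (hI : I ∈ imUnits m) (w : StemSpace m) :
    sliceMap I (Complex.I • w) = toCl I * sliceMap I w := by
  rw [sliceMap_apply, sliceMap_apply, mul_add, toCl_mul_toCl_mul hI, reL_I_smul, imL_I_smul,
    add_comm]

theorem sliceMap_unslice {I : Para m} (hI : I ∈ imUnits m) (v : Cl m) :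
    sliceMap I (unslice I v) = v := by
  rw [unslice_apply, map_smul, map_sub, sliceMap_I_smul hI, sliceMap_apply, sliceMap_apply]
  simp only [reL_complexify, imL_complexify, mul_zero, add_zero, toCl_mul_toCl_mul hI]
  module

/-- This makes `unslice I` turn a solution of `∂̄_I f = 0` into an honest holomorphic function, so
that complex analysis applies. -/
theorem unslice_toCl_mul {I : Para m} (hI : I ∈ imUnits m) (v : Cl m) :
    unslice I (toCl I * v) = Complex.I • unslice I v := by
  rw [unslice_apply, unslice_apply, toCl_mul_toCl_mul hI, smul_comm Complex.I (1 / 2 : ℝ),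
    smul_sub Complex.I, smul_smul Complex.I, Complex.I_mul_I, map_neg]
  module

theorem unslice_injective {I : Para m} (hI : I ∈ imUnits m) :
    Function.Injective (unslice I) :=
  Function.LeftInverse.injective (sliceMap_unslice hI)

theorem toCl_phi {I : Para m} (hI : I ∈ imUnits m) (z : ℂ) :
    toCl (phi I z) = algebraMap ℝ (Cl m) z.re + z.im • toCl I := by
  rw [toCl_eq_imCl hI]
  simp [toCl, imCl, phi, hI.1, Finset.smul_sum, smul_smul]

theorem conjCl_phi {I : Para m} (hI : I ∈ imUnits m) (z : ℂ) :
    conjCl (phi I z) = toCl (phi I ((starRingEnd ℂ) z)) := by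
  rw [toCl_phi hI, toCl_eq_imCl hI]
  simp [conjCl, imCl, phi, hI.1, Finset.smul_sum, smul_smul, sub_eq_add_neg]

theorem sliceMap_smul {I : Para m} (hI : I ∈ imUnits m) (z : ℂ) (w : StemSpace m) :
    sliceMap I (z • w) = toCl (phi I z) * sliceMap I w := by
  have h : z • w = z.re • w + z.im • (Complex.I • w) := by
    conv_lhs => rw [← Complex.re_add_im z]
    rw [add_smul, mul_smul, Complex.coe_smul, Complex.coe_smul]
  rw [h, map_add, map_smul, map_smul, sliceMap_I_smul hI, toCl_phi hI, add_mul,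
    ← Algebra.smul_def, smul_mul_assoc]

theorem sliceMap_pow_smul {I : Para m} (hI : I ∈ imUnits m) (z : ℂ) (k : ℕ) (w : StemSpace m) :
    sliceMap I (z ^ k • w) = toCl (phi I z) ^ k * sliceMap I w := by
  induction k with
  | zero => simp
  | succ k ih => rw [pow_succ', mul_smul, sliceMap_smul hI, ih, pow_succ', mul_assoc]

theorem sliceMap_neg (I : Para m) (w : StemSpace m) :
    sliceMap (-I) w = sliceMap I (star w) := by
  simp [sliceMap_apply, toCl_neg]

/-- A single `sliceMap I` has a kernel; the values `a + Ib` and `a - Ib` together determine `a` and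
`b`. -/
theorem eq_zero_of_sliceMap {I : Para m} (hI : I ∈ imUnits m) {w : StemSpace m}
    (h₁ : sliceMap I w = 0) (h₂ : sliceMap (-I) w = 0) : w = 0 := by
  rw [sliceMap_apply] at h₁ h₂
  rw [toCl_neg] at h₂
  have hre : reL m w = 0 := by
    have : (2 : ℝ) • reL m w = 0 := by
      rw [two_smul]
      calc reL m w + reL m w
          = (reL m w + toCl I * imL m w) + (reL m w + -toCl I * imL m w) := by noncomm_ring
        _ = 0 := by rw [h₁, h₂, add_zero]
    exact (smul_eq_zero.1 this).resolve_left two_ne_zero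
  have him : imL m w = 0 := by
    rw [hre, zero_add] at h₁
    have := toCl_mul_toCl_mul hI (imL m w)
    rw [h₁, mul_zero] at this
    exact neg_eq_zero.1 this.symm
  rw [← complexify_re_add_im w, hre, him]
  simp

/-! ### Slices of paravector space and the planar domain -/

/-- `φ_I` as a continuous linear map. -/
def phiL (I : Para m) : ℂ →L[ℝ] Para m :=
  Complex.reCLM.smulRight (EuclideanSpace.single 0 1) + Complex.imCLM.smulRight I

@[simp] theorem phiL_apply (I : Para m) (z : ℂ) : phiL I z = phi I z := rfl

@[simp] theorem phi_zero_coord {I : Para m} (hI : I ∈ imUnits m) (z : ℂ) : phi I z 0 = z.re := by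
  simp [phi, hI.1]

@[simp] theorem phi_succ_coord (I : Para m) (z : ℂ) (j : Fin m) :
    phi I z j.succ = z.im * I j.succ := by
  simp [phi]

theorem imNormSq_phi {I : Para m} (hI : I ∈ imUnits m) (z : ℂ) :
    imNormSq (phi I z) = z.im ^ 2 := by
  have h : imNormSq I = 1 := hI.2
  unfold imNormSq at h ⊢
  simp only [phi_succ_coord, mul_pow, ← Finset.mul_sum, h, mul_one]

theorem imNormSq_nonneg (x : Para m) : 0 ≤ imNormSq x :=
  Finset.sum_nonneg fun _ _ => sq_nonneg _

theorem norm_phi {I : Para m} (hI : I ∈ imUnits m) (z : ℂ) : ‖phi I z‖ = ‖z‖ := by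
  rw [EuclideanSpace.norm_eq, Fin.sum_univ_succ, Complex.norm_eq_sqrt_sq_add_sq]
  have := imNormSq_phi hI z
  unfold imNormSq at this
  simp only [Real.norm_eq_abs, sq_abs, phi_zero_coord hI, this]

theorem imNormSq_eq_zero_iff (x : Para m) : imNormSq x = 0 ↔ x ∈ realAxis m := by
  rw [imNormSq, Finset.sum_eq_zero_iff_of_nonneg fun _ _ => sq_nonneg _]
  simp [realAxis]

/-- The point `x₀ + i |Im x|` of the closed upper half plane. -/
def upper (x : Para m) : ℂ := ⟨x 0, √(imNormSq x)⟩

theorem continuous_imNormSq : Continuous (imNormSq : Para m → ℝ) := by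
  unfold imNormSq
  fun_prop

theorem continuous_upper : Continuous (upper : Para m → ℂ) := by
  have h : (upper : Para m → ℂ) =
      fun x => ((x 0 : ℝ) : ℂ) + ((√(imNormSq x) : ℝ) : ℂ) * Complex.I := by
    ext x
    simp [upper, Complex.mk_eq_add_mul_I]
  rw [h]
  have := continuous_imNormSq (m := m)
  fun_prop

theorem imUnits_nonempty (hm : 1 ≤ m) : (imUnits m).Nonempty := by
  obtain ⟨j⟩ : Nonempty (Fin m) := ⟨⟨0, hm⟩⟩
  refine ⟨EuclideanSpace.single j.succ 1, by simp, ?_⟩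
  simp [imNormSq, PiLp.single_apply, Fin.succ_inj]

theorem exists_eq_phi_upper (hm : 1 ≤ m) (x : Para m) :
    ∃ I ∈ imUnits m, x = phi I (upper x) := by
  by_cases hx : imNormSq x = 0
  · obtain ⟨I, hI⟩ := imUnits_nonempty hm
    refine ⟨I, hI, ?_⟩
    have h := (imNormSq_eq_zero_iff x).1 hx
    ext j
    refine Fin.cases ?_ (fun j => ?_) j
    · rw [phi_zero_coord hI]; rfl
    · rw [phi_succ_coord, h j]
      simp [upper, hx]
  · have hpos : 0 < √(imNormSq x) :=
      Real.sqrt_pos.2 (lt_of_le_of_ne (imNormSq_nonneg x) (Ne.symm hx))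
    have hI : (√(imNormSq x))⁻¹ • (x - x 0 • EuclideanSpace.single 0 1) ∈ imUnits m := by
      refine ⟨by simp, ?_⟩
      have : imNormSq x = ∑ j : Fin m, x j.succ ^ 2 := rfl
      simp only [imNormSq, PiLp.smul_apply, PiLp.sub_apply, smul_eq_mul, mul_pow, ← Finset.mul_sum,
        PiLp.single_apply, Fin.succ_ne_zero, if_false, mul_zero, sub_zero, inv_pow]
      rw [← this, Real.sq_sqrt (imNormSq_nonneg x), inv_mul_cancel₀ hx]
    refine ⟨_, hI, ?_⟩
    rw [phi, smul_smul]
    simp only [upper]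
    rw [mul_inv_cancel₀ hpos.ne', one_smul]
    abel

theorem phi_mem {Ω : Set (Para m)} (hΩ : IsCircular Ω) {I : Para m} (hI : I ∈ imUnits m) {z : ℂ}
    (hz : z ∈ planar Ω) : phi I z ∈ Ω := by
  rw [← circularization_planar hΩ]
  exact ⟨z, hz, I, hI, rfl⟩

theorem planar_eq_preimage {Ω : Set (Para m)} (hΩ : IsCircular Ω) {I : Para m}
    (hI : I ∈ imUnits m) : planar Ω = phiL I ⁻¹' Ω :=
  Set.ext fun _ => ⟨fun hz => phi_mem hΩ hI hz, fun hz => ⟨I, hI, hz⟩⟩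

theorem isOpen_planar (hm : 1 ≤ m) {Ω : Set (Para m)} (hΩ : IsCircular Ω) (ho : IsOpen Ω) :
    IsOpen (planar Ω) := by
  obtain ⟨I, hI⟩ := imUnits_nonempty hm
  rw [planar_eq_preimage hΩ hI]
  exact ho.preimage (phiL I).continuous

theorem upper_mem_planar (hm : 1 ≤ m) {Ω : Set (Para m)} {x : Para m} (hx : x ∈ Ω) :
    upper x ∈ planar Ω := by
  obtain ⟨I, hI, h⟩ := exists_eq_phi_upper hm x
  exact ⟨I, hI, h ▸ hx⟩

theorem upper_phi {I : Para m} (hI : I ∈ imUnits m) (z : ℂ) :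
    upper (phi I z) = ⟨z.re, |z.im|⟩ := by
  simp [upper, phi_zero_coord hI, imNormSq_phi hI, Real.sqrt_sq_eq_abs]

theorem upper_of_mem_realAxis {x : Para m} (hx : x ∈ realAxis m) : upper x = (x 0 : ℝ) := by
  apply Complex.ext <;> simp [upper, (imNormSq_eq_zero_iff x).2 hx]

/-- A circular connected set meeting the real axis has a connected planar domain. -/
theorem isPreconnected_planar (hm : 1 ≤ m) {Ω : Set (Para m)} (hΩ : IsCircular Ω)
    (hc : IsConnected Ω) (hr : (Ω ∩ realAxis m).Nonempty) : IsPreconnected (planar Ω) := by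
  obtain ⟨I, hI⟩ := imUnits_nonempty hm
  -- `D` is the union of `upper '' Ω` and its complex conjugate, which share a real point because
  -- `Ω` meets the axis.
  have h₁ : IsPreconnected (upper '' Ω) :=
    hc.isPreconnected.image _ continuous_upper.continuousOn
  have h₂ : IsPreconnected ((starRingEnd ℂ) '' (upper '' Ω)) :=
    h₁.image _ Complex.continuous_conj.continuousOn
  obtain ⟨a, haΩ, ha⟩ := hr
  have hu := upper_of_mem_realAxis ha
  have ha₁ : upper a ∈ upper '' Ω := Set.mem_image_of_mem _ haΩ
  have ha₂ : upper a ∈ (starRingEnd ℂ) '' (upper '' Ω) :=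
    ⟨upper a, ha₁, by rw [hu, Complex.conj_ofReal]⟩
  have h := IsPreconnected.union (upper a) ha₁ ha₂ h₁ h₂
  convert h using 1
  ext z
  constructor
  · intro hz
    have hz' := phi_mem hΩ hI hz
    rcases le_total 0 z.im with hi | hi
    · exact Or.inl ⟨_, hz', by rw [upper_phi hI, abs_of_nonneg hi]⟩
    · exact Or.inr ⟨_, ⟨_, hz', rfl⟩, by
        rw [upper_phi hI, abs_of_nonpos hi]; apply Complex.ext <;> simp⟩
  · rintro (⟨x, hx, rfl⟩ | ⟨_, ⟨x, hx, rfl⟩, rfl⟩)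
    · exact upper_mem_planar hm hx
    · exact conj_mem_planar (upper_mem_planar hm hx)

theorem exists_ofReal_mem_planar (hm : 1 ≤ m) {Ω : Set (Para m)}
    (hr : (Ω ∩ realAxis m).Nonempty) : ∃ a : ℝ, (a : ℂ) ∈ planar Ω := by
  obtain ⟨a, haΩ, ha⟩ := hr
  exact ⟨a 0, upper_of_mem_realAxis ha ▸ upper_mem_planar hm haΩ⟩

theorem phi_mem_realAxis_iff {I : Para m} (hI : I ∈ imUnits m) (z : ℂ) :
    phi I z ∈ realAxis m ↔ z.im = 0 := by
  rw [← imNormSq_eq_zero_iff, imNormSq_phi hI, sq_eq_zero_iff]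

theorem phi_ofReal (I J : Para m) (t : ℝ) : phi I (t : ℂ) = phi J (t : ℂ) := by
  simp [phi]

theorem imCl_phi (I : Para m) (z : ℂ) : imCl (phi I z) = z.im • imCl I := by
  simp [imCl, Finset.smul_sum, smul_smul]

theorem phi_add (I : Para m) (z w : ℂ) : phi I (z + w) = phi I z + phi I w :=
  map_add (phiL I) z w

/-! ### Polyanalytic functions of one complex variable -/

section Polyanalytic

variable {E : Type*} [NormedAddCommGroup E] [NormedSpace ℂ E]

/-- The Cauchy–Riemann operator `½ (∂/∂α + i ∂/∂β)` on functions of a complex variable. -/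
def dbarC (F : ℂ → E) (z : ℂ) : E :=
  (1 / 2 : ℝ) • (fderiv ℝ F z 1 + Complex.I • fderiv ℝ F z Complex.I)

theorem dbarC_congr {F G : ℂ → E} {D : Set ℂ} (hD : IsOpen D) (h : Set.EqOn F G D) :
    Set.EqOn (dbarC F) (dbarC G) D := fun z hz => by
  rw [dbarC, dbarC, (h.eventuallyEq_of_mem (hD.mem_nhds hz)).fderiv_eq]

theorem dbarC_iterate_congr {F G : ℂ → E} {D : Set ℂ} (hD : IsOpen D) (h : Set.EqOn F G D)
    (n : ℕ) : Set.EqOn (dbarC^[n] F) (dbarC^[n] G) D := by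
  induction n generalizing F G with
  | zero => exact h
  | succ n ih => exact ih (dbarC_congr hD h)

theorem contDiffOn_dbarC {F : ℂ → E} {D : Set ℂ} (hD : IsOpen D) {n : ℕ}
    (h : ContDiffOn ℝ (n + 1 : ℕ) F D) : ContDiffOn ℝ n (dbarC F) D := by
  have h' : ContDiffOn ℝ n (fderiv ℝ F) D := h.fderiv_of_isOpen hD (by norm_cast)
  unfold dbarC
  exact ((h'.clm_apply contDiffOn_const).add
    ((h'.clm_apply contDiffOn_const).const_smul Complex.I)).const_smul (1 / 2 : ℝ)

theorem dbarC_eq_zero_iff {F : ℂ → E} {z : ℂ} (h : DifferentiableAt ℝ F z) :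
    dbarC F z = 0 ↔ DifferentiableAt ℂ F z := by
  rw [differentiableAt_complex_iff_differentiableAt_real, and_iff_right h, dbarC,
    smul_eq_zero_iff_right (by norm_num)]
  constructor
  · intro h₁
    have h₂ : Complex.I • (fderiv ℝ F z 1 + Complex.I • fderiv ℝ F z Complex.I) = 0 := by
      rw [h₁, smul_zero]
    rw [smul_add, smul_smul, Complex.I_mul_I, neg_one_smul] at h₂
    exact (sub_eq_zero.1 (by rw [sub_eq_add_neg]; exact h₂)).symm
  · intro h₁
    rw [h₁, smul_smul, Complex.I_mul_I, neg_one_smul, add_neg_cancel]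

theorem dbarC_sub {F G : ℂ → E} {z : ℂ} (hF : DifferentiableAt ℝ F z)
    (hG : DifferentiableAt ℝ G z) : dbarC (fun w => F w - G w) z = dbarC F z - dbarC G z := by
  rw [dbarC, dbarC, dbarC, fderiv_fun_sub hF hG]
  simp only [sub_apply]
  module

theorem dbarC_sum {ι : Type*} (s : Finset ι) {F : ι → ℂ → E} {z : ℂ}
    (hF : ∀ i ∈ s, DifferentiableAt ℝ (F i) z) :
    dbarC (fun w => ∑ i ∈ s, F i w) z = ∑ i ∈ s, dbarC (F i) z := by
  simp only [dbarC]
  rw [fderiv_fun_sum hF]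
  simp only [sum_apply, Finset.smul_sum, ← Finset.sum_add_distrib]

theorem differentiableAt_conj_pow (k : ℕ) (z : ℂ) :
    DifferentiableAt ℝ (fun w => (starRingEnd ℂ) w ^ k) z :=
  (Complex.conjCLE.differentiableAt (x := z)).pow k

theorem differentiableAt_conj_pow_smul (k : ℕ) {G : ℂ → E} {z : ℂ} (hG : DifferentiableAt ℂ G z) :
    DifferentiableAt ℝ (fun w => (starRingEnd ℂ) w ^ k • G w) z :=
  (differentiableAt_conj_pow k z).smul (hG.restrictScalars ℝ)

/-- Leibniz rule with `∂̄ z̄^k = k z̄^(k-1)` and `∂̄G = 0`. For `k = 0` the truncated exponent is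
harmless, since the factor `k` vanishes. -/
theorem dbarC_conj_pow_smul (k : ℕ) {G : ℂ → E} {z : ℂ} (hG : DifferentiableAt ℂ G z) :
    dbarC (fun w => (starRingEnd ℂ) w ^ k • G w) z =
      (starRingEnd ℂ) z ^ (k - 1) • ((k : ℂ) • G z) := by
  have hp : HasFDerivAt (fun w => (starRingEnd ℂ) w ^ k) _ z :=
    (Complex.conjCLE.hasFDerivAt (x := z)).pow k
  have h := hp.fun_smul (hG.restrictScalars ℝ).hasFDerivAt
  have h₀ := (dbarC_eq_zero_iff (hG.restrictScalars ℝ)).2 hG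
  rw [dbarC, smul_eq_zero_iff_right (by norm_num)] at h₀
  rw [dbarC, h.fderiv]
  rw [add_eq_zero_iff_eq_neg] at h₀
  simp only [add_apply, smul_apply,
    ContinuousLinearMap.smulRight_apply, h₀]
  simp only [ContinuousLinearEquiv.coe_coe, Complex.conjCLE_apply, map_one, Complex.conj_I]
  match_scalars
  · simp; ring
  · simp
    ring_nf
    simp
    ring

/-- A sum `∑_{h < n} z̄^h G_h(z)`. -/
def conjPolySum (n : ℕ) (G : ℕ → ℂ → E) (z : ℂ) : E :=
  ∑ h ∈ Finset.range n, (starRingEnd ℂ) z ^ h • G h z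

theorem differentiableAt_conjPolySum {n : ℕ} {G : ℕ → ℂ → E} {z : ℂ}
    (hG : ∀ h, DifferentiableAt ℂ (G h) z) : DifferentiableAt ℝ (conjPolySum n G) z := by
  unfold conjPolySum
  exact DifferentiableAt.fun_sum fun h _ => differentiableAt_conj_pow_smul h (hG h)

theorem dbarC_conjPolySum_succ {n : ℕ} {G : ℕ → ℂ → E} {z : ℂ}
    (hG : ∀ h, DifferentiableAt ℂ (G h) z) :
    dbarC (conjPolySum (n + 1) G) z =
      conjPolySum n (fun h w => ((h + 1 : ℕ) : ℂ) • G (h + 1) w) z := by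
  unfold conjPolySum
  rw [dbarC_sum _ fun h _ => differentiableAt_conj_pow_smul h (hG h), Finset.sum_range_succ']
  simp only [dbarC_conj_pow_smul _ (hG _)]
  simp

theorem dbarC_iterate_conjPolySum {D : Set ℂ} (hD : IsOpen D) (n : ℕ) {G : ℕ → ℂ → E}
    (hG : ∀ h, DifferentiableOn ℂ (G h) D) : ∀ z ∈ D, (dbarC^[n] (conjPolySum n G)) z = 0 := by
  induction n generalizing G with
  | zero => intro z _; simp [conjPolySum]
  | succ n ih =>
    intro z hz
    rw [Function.iterate_succ_apply, dbarC_iterate_congr hD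
      (fun w hw => dbarC_conjPolySum_succ fun h => (hG h).differentiableAt (hD.mem_nhds hw)) n hz]
    exact ih (fun h => (hG (h + 1)).const_smul _) z hz

/-- Polyanalytic functions are polynomials in `z̄` with holomorphic coefficients. -/
theorem exists_eq_conjPolySum {D : Set ℂ} (hD : IsOpen D) (n : ℕ) {F : ℂ → E}
    (hF : ContDiffOn ℝ n F D) (h₀ : ∀ z ∈ D, (dbarC^[n] F) z = 0) :
    ∃ G : ℕ → ℂ → E, (∀ h, DifferentiableOn ℂ (G h) D) ∧ Set.EqOn F (conjPolySum n G) D := by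
  induction n generalizing F with
  | zero =>
    exact ⟨0, fun h => differentiableOn_const 0, fun z hz => by simpa [conjPolySum] using h₀ z hz⟩
  | succ n ih =>
    obtain ⟨G, hG, hFG⟩ := ih (contDiffOn_dbarC hD hF) h₀
    -- `H` gives the termwise antiderivative in `z̄` of `∑ z̄^h G_h = ∂̄F`, with zero constant term.
    -- It is explicit and global, so no topology of `D` enters; the holomorphic remainder `F - ∑
    -- z̄^h H_h` becomes the new coefficient of `z̄^0`.
    set H : ℕ → ℂ → E := fun h => Nat.casesOn h 0 fun k w => ((k + 1 : ℕ) : ℂ)⁻¹ • G k w with hH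
    have hHd : ∀ h, DifferentiableOn ℂ (H h) D := by
      rintro (_ | k)
      · exact differentiableOn_const 0
      · exact (hG k).const_smul _
    have hHz : ∀ z ∈ D, ∀ h, DifferentiableAt ℂ (H h) z := fun z hz h =>
      (hHd h).differentiableAt (hD.mem_nhds hz)
    have hFz : ∀ z ∈ D, DifferentiableAt ℝ F z := fun z hz =>
      (hF.contDiffAt (hD.mem_nhds hz)).differentiableAt (by simp)
    have hK : DifferentiableOn ℂ (fun z => F z - conjPolySum (n + 1) H z) D := fun z hz => by
      have hs := differentiableAt_conjPolySum (n := n + 1) (hHz z hz)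
      refine ((dbarC_eq_zero_iff ((hFz z hz).fun_sub hs)).1 ?_).differentiableWithinAt
      rw [dbarC_sub (hFz z hz) hs, hFG hz, dbarC_conjPolySum_succ (hHz z hz), sub_eq_zero]
      unfold conjPolySum
      refine Finset.sum_congr rfl fun h _ => ?_
      simp only [hH]
      rw [smul_smul ((h + 1 : ℕ) : ℂ), mul_inv_cancel₀ (Nat.cast_ne_zero.2 h.succ_ne_zero),
        one_smul]
    refine ⟨fun h => Nat.casesOn h (fun z => F z - conjPolySum (n + 1) H z) fun k => H (k + 1),
      ?_, fun z _ => ?_⟩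
    · rintro (_ | k)
      · exact hK
      · exact hHd (k + 1)
    · have h₁ : conjPolySum (n + 1) H z =
          ∑ k ∈ Finset.range n, (starRingEnd ℂ) z ^ (k + 1) • H (k + 1) z := by
        rw [conjPolySum, Finset.sum_range_succ']
        simp [hH]
      conv_rhs => rw [conjPolySum, Finset.sum_range_succ']
      simp only [pow_zero, one_smul]
      rw [← h₁]
      exact (add_sub_cancel _ _).symm

theorem contDiffOn_conjPolySum [CompleteSpace E] {D : Set ℂ} (hD : IsOpen D) (n : ℕ)
    {G : ℕ → ℂ → E} (hG : ∀ h, DifferentiableOn ℂ (G h) D) (k : ℕ) :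
    ContDiffOn ℝ k (conjPolySum n G) D := by
  unfold conjPolySum
  refine ContDiffOn.sum fun h _ => ContDiffOn.smul ?_ ?_
  · exact (Complex.conjCLE.contDiff.pow h).contDiffOn
  · exact ((hG h).contDiffOn hD).restrict_scalars ℝ

end Polyanalytic

/-! ### Stem functions and the representation formula -/

/-- A function `F₁ + i F₂` with values in `ℝ_m ⊗ ℂ` that is compatible with conjugation. -/
def IsStemOn {m : ℕ} (D : Set ℂ) (F : ℂ → StemSpace m) : Prop :=
  ∀ z ∈ D, F ((starRingEnd ℂ) z) = star (F z)

/-- The symmetrization `½ (F(z) + conj F(z̄))`. -/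
def symmetrize (F : ℂ → StemSpace m) (z : ℂ) : StemSpace m :=
  (1 / 2 : ℂ) • (F z + star (F ((starRingEnd ℂ) z)))

theorem isStemOn_symmetrize (D : Set ℂ) (F : ℂ → StemSpace m) : IsStemOn D (symmetrize F) := by
  intro z _
  simp only [symmetrize, Complex.conj_conj, star_smul, star_add, star_star]
  rw [add_comm]
  simp

/-- Schwarz reflection in each coordinate. -/
theorem differentiableOn_star_conj {D : Set ℂ} (hD : IsOpen D)
    (hc : ∀ z ∈ D, (starRingEnd ℂ) z ∈ D) {F : ℂ → StemSpace m} (hF : DifferentiableOn ℂ F D) :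
    DifferentiableOn ℂ (fun z => star (F ((starRingEnd ℂ) z))) D := by
  rw [differentiableOn_pi]
  intro j z hz
  have h : DifferentiableAt ℂ (fun w => F w j) ((starRingEnd ℂ) z) :=
    differentiableAt_pi.1 (hF.differentiableAt (hD.mem_nhds (hc z hz))) j
  have := h.conj_conj
  rw [Complex.conj_conj] at this
  exact this.differentiableWithinAt

theorem differentiableOn_symmetrize {D : Set ℂ} (hD : IsOpen D)
    (hc : ∀ z ∈ D, (starRingEnd ℂ) z ∈ D) {F : ℂ → StemSpace m} (hF : DifferentiableOn ℂ F D) :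
    DifferentiableOn ℂ (symmetrize F) D :=
  (hF.fun_add (differentiableOn_star_conj hD hc hF)).fun_const_smul _

theorem symmetrize_of_isStemOn {D : Set ℂ} {F : ℂ → StemSpace m} (hF : IsStemOn D F) {z : ℂ}
    (hz : z ∈ D) : symmetrize F z = F z := by
  rw [symmetrize, hF z hz, star_star, ← two_smul ℂ, smul_smul]
  norm_num

/-- The coefficients of a polyanalytic stem function need not be stem functions. Averaging `F(z)`
with `star (F(z̄))` leaves `F` unchanged, fixes each `z̄^k` and symmetrizes each coefficient. -/
theorem eqOn_conjPolySum_symmetrize {D : Set ℂ} (hc : ∀ z ∈ D, (starRingEnd ℂ) z ∈ D) {n : ℕ}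
    {F : ℂ → StemSpace m} (hF : IsStemOn D F) {G : ℕ → ℂ → StemSpace m}
    (h : Set.EqOn F (conjPolySum n G) D) :
    Set.EqOn F (conjPolySum n fun k => symmetrize (G k)) D := by
  intro z hz
  rw [← symmetrize_of_isStemOn hF hz, symmetrize, h hz, h (hc z hz), conjPolySum, conjPolySum,
    conjPolySum, star_sum, ← Finset.sum_add_distrib, Finset.smul_sum]
  refine Finset.sum_congr rfl fun k _ => ?_
  rw [symmetrize, star_smul, smul_comm _ (1 / 2 : ℂ), smul_add]
  simp

theorem dbar_eq_sliceMap {I : Para m} (hI : I ∈ imUnits m) {f : Para m → Cl m}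
    {F : ℂ → StemSpace m} {D : Set ℂ} (hD : IsOpen D)
    (h : ∀ z ∈ D, f (phi I z) = sliceMap I (F z)) {z : ℂ} (hz : z ∈ D)
    (hF : DifferentiableAt ℝ F z) : dbar I f z = sliceMap I (dbarC F z) := by
  have he : (fun w => f (phi I w)) =ᶠ[nhds z] fun w => sliceMap I (F w) :=
    Filter.eventually_of_mem (hD.mem_nhds hz) h
  have hd : fderiv ℝ (fun w => sliceMap I (F w)) z = (sliceMap I).comp (fderiv ℝ F z) :=
    ((sliceMap I).hasFDerivAt.comp z hF.hasFDerivAt).fderiv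
  rw [dbar, he.fderiv_eq, hd, dbarC, map_smul, map_add, sliceMap_I_smul hI]
  rfl

theorem dbarC_unslice {I : Para m} (hI : I ∈ imUnits m) {f : Para m → Cl m} {z : ℂ}
    (hf : DifferentiableAt ℝ (fun w => f (phi I w)) z) :
    dbarC (fun w => unslice I (f (phi I w))) z = unslice I (dbar I f z) := by
  have hd : fderiv ℝ (fun w => unslice I (f (phi I w))) z =
      (unslice I).comp (fderiv ℝ (fun w => f (phi I w)) z) :=
    ((unslice I).hasFDerivAt.comp z hf.hasFDerivAt).fderiv
  rw [dbarC, hd, dbar, map_smul, map_add, unslice_toCl_mul hI]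
  rfl

theorem differentiableAt_comp_phi {f : Para m → Cl m} {I : Para m} {z : ℂ}
    (hf : DifferentiableAt ℝ f (phi I z)) : DifferentiableAt ℝ (fun w => f (phi I w)) z :=
  DifferentiableAt.comp z (f := phiL I) hf (phiL I).differentiableAt

theorem reL_unslice (I : Para m) (v : Cl m) : reL m (unslice I v) = (1 / 2 : ℝ) • v := by
  simp [unslice_apply]

theorem sliceMap_eq_reL_of_star_eq (I : Para m) {w : StemSpace m} (hw : star w = w) :
    sliceMap I w = reL m w := by
  have h := imL_star w
  rw [hw, eq_neg_iff_add_eq_zero, ← two_smul ℝ] at h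
  rw [sliceMap_apply, (smul_eq_zero.1 h).resolve_left two_ne_zero, mul_zero, add_zero]

/-- The representation formula: slice monogenic functions are induced by holomorphic stem
functions. -/
theorem exists_stem_of_mem_sliceMonogenic (hm : 1 ≤ m) {Ω : Set (Para m)} (ho : IsOpen Ω)
    (hΩ : IsCircular Ω) (hc : IsConnected Ω) (hr : (Ω ∩ realAxis m).Nonempty)
    {f : Para m → Cl m} (hf : f ∈ sliceMonogenic Ω) :
    ∃ F : ℂ → StemSpace m, IsStemOn (planar Ω) F ∧ DifferentiableOn ℂ F (planar Ω) ∧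
      ∀ I ∈ imUnits m, ∀ z ∈ planar Ω, f (phi I z) = sliceMap I (F z) := by
  have hD := isOpen_planar hm hΩ ho
  obtain ⟨a, ha⟩ := exists_ofReal_mem_planar hm hr
  have hdiff : ∀ I ∈ imUnits m, ∀ z ∈ planar Ω,
      DifferentiableAt ℝ (fun w => f (phi I w)) z := fun I hI z hz =>
    differentiableAt_comp_phi
      ((hf.1.contDiffAt (ho.mem_nhds (phi_mem hΩ hI hz))).differentiableAt one_ne_zero)
  have hol : ∀ I ∈ imUnits m,
      DifferentiableOn ℂ (fun z => unslice I (f (phi I z))) (planar Ω) := fun I hI z hz => by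
    have hd := hdiff I hI z hz
    refine ((dbarC_eq_zero_iff ?_).1 ?_).differentiableWithinAt
    · exact (unslice I).differentiableAt.comp z hd
    · rw [dbarC_unslice hI hd, hf.2 I hI z hz, map_zero]
  obtain ⟨J, hJ⟩ := imUnits_nonempty hm
  -- With the factor `2`, `F(t) = u + star u` at real `t`, where `u = unslice J (f t)` has real part
  -- `f(t) / 2`; so `F` restricts to `f` on the real axis.
  set F : ℂ → StemSpace m := symmetrize fun z => (2 : ℂ) • unslice J (f (phi J z)) with hF
  have hFd : DifferentiableOn ℂ F (planar Ω) :=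
    differentiableOn_symmetrize hD (fun _ => conj_mem_planar) ((hol J hJ).const_smul (2 : ℂ))
  refine ⟨F, isStemOn_symmetrize _ _, hFd, fun I hI z hz => ?_⟩
  have hreal : ∀ t : ℝ, f (phi I t) = sliceMap I (F t) := fun t => by
    have hs : star (F t) = F t := by
      have := isStemOn_symmetrize Set.univ (fun z => (2 : ℂ) • unslice J (f (phi J z))) t trivial
      rw [Complex.conj_ofReal] at this
      exact this.symm
    have hv : F t = unslice J (f (phi J t)) + star (unslice J (f (phi J t))) := by
      simp [hF, symmetrize]
    rw [sliceMap_eq_reL_of_star_eq I hs, hv, map_add, reL_star, reL_unslice, ← add_smul,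
      phi_ofReal I J]
    norm_num
  -- `unslice I ∘ sliceMap I` commutes with `i`, so it preserves holomorphy.
  have hsl : DifferentiableOn ℂ (fun z => unslice I (sliceMap I (F z))) (planar Ω) := by
    intro z hz
    have hFz := (hFd.differentiableAt (hD.mem_nhds hz))
    have h₁ := (sliceMap I).hasFDerivAt.comp z (hFz.restrictScalars ℝ).hasFDerivAt
    have h₂ := (unslice I).hasFDerivAt.comp z h₁
    refine ((dbarC_eq_zero_iff h₂.differentiableAt).1 ?_).differentiableWithinAt
    have h₀ := (dbarC_eq_zero_iff (hFz.restrictScalars ℝ)).2 hFz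
    rw [dbarC, h₂.fderiv]
    simp only [ContinuousLinearMap.comp_apply]
    rw [← unslice_toCl_mul hI, ← sliceMap_I_smul hI, ← map_add, ← map_add, ← map_smul, ← map_smul]
    rw [dbarC] at h₀
    rw [h₀, map_zero, map_zero]
  -- Identity theorem: the two holomorphic lifts agree at real points accumulating at `a`, hence on
  -- all of `D`.
  have hd := ((hol I hI).sub hsl).analyticOnNhd hD
  have hfreq : ∃ᶠ z in nhdsWithin (a : ℂ) {(a : ℂ)}ᶜ,
      ((fun z => unslice I (f (phi I z))) - fun z => unslice I (sliceMap I (F z))) z = 0 := by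
    have ht : Filter.Tendsto (fun t : ℝ => (t : ℂ)) (nhdsWithin a {a}ᶜ)
        (nhdsWithin (a : ℂ) {(a : ℂ)}ᶜ) := by
      refine tendsto_nhdsWithin_of_tendsto_nhds_of_eventually_within _
        (Complex.continuous_ofReal.continuousAt.tendsto.mono_left nhdsWithin_le_nhds) ?_
      filter_upwards [self_mem_nhdsWithin] with t ht
      simpa using ht
    refine ht.frequently (Filter.Eventually.frequently (Filter.Eventually.of_forall fun t => ?_))
    simp only [Pi.sub_apply, hreal t, sub_self]
  have hz0 := hd.eqOn_zero_of_preconnected_of_frequently_eq_zero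
    (isPreconnected_planar hm hΩ hc hr) ha hfreq hz
  exact unslice_injective hI (sub_eq_zero.1 hz0)

/-! ### Power series at real points and real analyticity -/

theorem complexify_reL (w : StemSpace m) :
    complexify m (reL m w) = (1 / 2 : ℂ) • (w + star w) := by
  conv_rhs => rw [← complexify_re_add_im w]
  rw [star_add, star_smul, star_complexify, star_complexify]
  simp only [RCLike.star_def, Complex.conj_I]
  module

/-- Power series expansion of a stem function at a real point; the coefficients lie in `ℝ_m`. -/
theorem exists_hasSum_sliceMap {D : Set ℂ} (hD : IsOpen D) {F : ℂ → StemSpace m}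
    (hF : DifferentiableOn ℂ F D) (hs : IsStemOn D F) {a : ℝ} (ha : (a : ℂ) ∈ D) :
    ∃ r : NNReal, 0 < r ∧ Metric.ball (a : ℂ) r ⊆ D ∧ ∃ (c : ℕ → Cl m) (C : ℝ),
      (∀ k, ‖c k‖ * (r : ℝ) ^ k ≤ C) ∧ ∀ I ∈ imUnits m, ∀ y : ℂ, ‖y‖ < r →
        HasSum (fun k => toCl (phi I y) ^ k * c k) (sliceMap I (F (a + y))) := by
  obtain ⟨R, hR, hRD⟩ := Metric.nhds_basis_closedBall.mem_iff.1 (hD.mem_nhds ha)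
  lift R to NNReal using hR.le
  have hR' : 0 < R := by exact_mod_cast hR
  have hp := (hF.mono hRD).hasFPowerSeriesOnBall hR'
  set p := cauchyPowerSeries F a R
  have hr2 : R / 2 < R := NNReal.half_lt_self hR'.ne'
  have hsub : Metric.ball (a : ℂ) (R / 2 : NNReal) ⊆ D :=
    (Metric.ball_subset_closedBall.trans
      (Metric.closedBall_subset_closedBall (by exact_mod_cast hr2.le))).trans hRD
  obtain ⟨C, hC, hpC⟩ := p.norm_mul_pow_le_of_lt_radius
    (lt_of_lt_of_le (ENNReal.coe_lt_coe.2 hr2) hp.r_le)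
  refine ⟨R / 2, half_pos hR', hsub, fun k => reL m (p.coeff k), ‖reL m‖ * C, fun k => ?_,
    fun I hI y hy => ?_⟩
  · have h₁ : ‖p.coeff k‖ ≤ ‖p k‖ := by
      have := (p k).le_opNorm (1 : Fin k → ℂ)
      simp only [Pi.one_apply, norm_one, Finset.prod_const_one, mul_one] at this
      exact this
    calc ‖reL m (p.coeff k)‖ * ((R / 2 : NNReal) : ℝ) ^ k
        ≤ (‖reL m‖ * ‖p k‖) * ((R / 2 : NNReal) : ℝ) ^ k := by
          gcongr
          exact ((reL m).le_opNorm _).trans (by gcongr)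
      _ ≤ ‖reL m‖ * C := by
          rw [mul_assoc]
          gcongr
          exact hpC k
  · have hsum : ∀ u : ℂ, ‖u‖ < (R / 2 : NNReal) →
        HasSum (fun k => u ^ k • p.coeff k) (F (a + u)) := fun u hu => by
      have hu' : u ∈ Metric.eball (0 : ℂ) R := by
        rw [Metric.mem_eball, edist_zero_right, enorm_eq_nnnorm, ENNReal.coe_lt_coe]
        exact lt_trans (by exact_mod_cast hu) hr2
      simpa [FormalMultilinearSeries.apply_eq_pow_smul_coeff] using hp.hasSum hu'
    have hmem : (a : ℂ) + y ∈ D := hsub (by simpa using hy)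
    -- Averaging the expansion at `y` with the conjugate of the expansion at `ȳ` replaces each
    -- coefficient by its real part, an element of `ℝ_m`.
    have h₂ := (hsum ((starRingEnd ℂ) y) (by simpa using hy)).star
    have h₃ : star (F (a + (starRingEnd ℂ) y)) = F (a + y) := by
      have := hs _ hmem
      rw [map_add, Complex.conj_ofReal] at this
      rw [this, star_star]
    rw [h₃] at h₂
    have h₄ := ((hsum y hy).add h₂).const_smul (1 / 2 : ℂ)
    rw [← two_smul ℂ (F (a + y)), smul_smul] at h₄
    norm_num at h₄
    convert (sliceMap I).hasSum h₄ using 1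
    ext1 k
    have : (1 / 2 : ℂ) • y ^ k • p.coeff k + (1 / 2 : ℂ) • y ^ k • star (p.coeff k) =
        y ^ k • complexify m (reL m (p.coeff k)) := by
      rw [complexify_reL]
      module
    rw [this, sliceMap_pow_smul hI, sliceMap_apply, reL_complexify,
      imL_complexify, mul_zero, add_zero]

/-- `x ↦ ∑ x_j e_j` as a continuous linear map. -/
def imClL (m : ℕ) : Para m →L[ℝ] Cl m :=
  ∑ j : Fin m, (EuclideanSpace.proj j.succ : Para m →L[ℝ] ℝ).smulRight (gen m j)

@[simp] theorem imClL_apply (x : Para m) : imClL m x = imCl x := by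
  simp [imClL, imCl]

/-- `x ↦ x₀ + ∑ x_j e_j` as a continuous linear map. -/
def toClL (m : ℕ) : Para m →L[ℝ] Cl m :=
  (EuclideanSpace.proj 0 : Para m →L[ℝ] ℝ).smulRight 1 + imClL m

@[simp] theorem toClL_apply (x : Para m) : toClL m x = toCl x := by
  simp [toClL, toCl, Algebra.algebraMap_eq_smul_one]

/-- `x ↦ x₀ - ∑ x_j e_j` as a continuous linear map. -/
def conjClL (m : ℕ) : Para m →L[ℝ] Cl m :=
  (EuclideanSpace.proj 0 : Para m →L[ℝ] ℝ).smulRight 1 - imClL m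

@[simp] theorem conjClL_apply (x : Para m) : conjClL m x = conjCl x := by
  simp [conjClL, conjCl, Algebra.algebraMap_eq_smul_one]

/-- The power series `y ↦ ∑ y^k c_k` on the paravectors. -/
def paraSeries (c : ℕ → Cl m) : FormalMultilinearSeries ℝ (Para m) (Cl m) := fun k =>
  (ContinuousLinearMap.apply ℝ (Cl m) (c k)).compContinuousMultilinearMap
    ((ContinuousMultilinearMap.mkPiAlgebraFin ℝ k (Cl m →L[ℝ] Cl m)).compContinuousLinearMap
      fun _ => mulL m ∘L toClL m)

theorem paraSeries_apply (c : ℕ → Cl m) (k : ℕ) (y : Para m) :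
    paraSeries c k (fun _ => y) = toCl y ^ k * c k := by
  have h : ∀ k : ℕ, ∀ v : Cl m, (mulL m (toCl y) ^ k) v = toCl y ^ k * v := by
    intro k
    induction k with
    | zero => intro v; simp
    | succ k ih =>
      intro v
      rw [pow_succ, mul_apply_eq_comp, ih, mulL_apply, pow_succ, mul_assoc]
  simp [paraSeries, List.ofFn_const, h]

/-- The chosen norm on `ℝ_m` need not be submultiplicative, so powers are estimated in the normed
algebra of operators, through left multiplication. -/
theorem norm_paraSeries_le (c : ℕ → Cl m) (k : ℕ) :
    ‖paraSeries c k‖ ≤ max 1 ‖(1 : Cl m →L[ℝ] Cl m)‖ * ‖mulL m ∘L toClL m‖ ^ k * ‖c k‖ := by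
  have h₁ := ContinuousMultilinearMap.norm_mkPiAlgebraFin_le (𝕜 := ℝ) (n := k)
    (A := Cl m →L[ℝ] Cl m)
  have h₂ := ContinuousMultilinearMap.norm_compContinuousLinearMap_le
    (ContinuousMultilinearMap.mkPiAlgebraFin ℝ k (Cl m →L[ℝ] Cl m))
    fun _ => mulL m ∘L toClL m
  rw [Fin.prod_const] at h₂
  have h₃ : ‖ContinuousLinearMap.apply ℝ (Cl m) (c k)‖ ≤ ‖c k‖ :=
    ContinuousLinearMap.opNorm_le_bound _ (norm_nonneg _) fun T => by
      rw [mul_comm]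
      exact T.le_opNorm (c k)
  calc ‖paraSeries c k‖ ≤ ‖ContinuousLinearMap.apply ℝ (Cl m) (c k)‖ *
        ‖(ContinuousMultilinearMap.mkPiAlgebraFin ℝ k (Cl m →L[ℝ] Cl m)).compContinuousLinearMap
          fun _ => mulL m ∘L toClL m‖ :=
        ContinuousLinearMap.norm_compContinuousMultilinearMap_le _ _
    _ ≤ ‖c k‖ * (max 1 ‖(1 : Cl m →L[ℝ] Cl m)‖ * ‖mulL m ∘L toClL m‖ ^ k) := by
        gcongr
        exact h₂.trans (by gcongr)
    _ = _ := by ring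

theorem radius_paraSeries_pos {c : ℕ → Cl m} {r : NNReal} (hr : 0 < r) {C : ℝ}
    (hc : ∀ k, ‖c k‖ * (r : ℝ) ^ k ≤ C) : 0 < (paraSeries c).radius := by
  set L : ℝ := ‖mulL m ∘L toClL m‖
  set M : ℝ := max 1 ‖(1 : Cl m →L[ℝ] Cl m)‖
  -- The radius shrinks by the norm `L` of `y ↦ (left multiplication by y)`, so that `L * s ≤ r`;
  -- the `+ 1` avoids dividing by zero.
  set s : NNReal := r / (‖mulL m ∘L toClL m‖₊ + 1) with hs
  have hs0 : 0 < s := by positivity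
  have hsr : L * s ≤ r := by
    have : (s : ℝ) = r / (L + 1) := by rw [hs]; push_cast; rfl
    have hL : 0 ≤ L := norm_nonneg (mulL m ∘L toClL m)
    rw [this, mul_div_assoc', div_le_iff₀ (by positivity)]
    nlinarith [r.coe_nonneg]
  refine lt_of_lt_of_le (ENNReal.coe_pos.2 hs0)
    ((paraSeries c).le_radius_of_bound (M * C) fun k => ?_)
  have hM : 0 ≤ M := zero_le_one.trans (le_max_left _ _)
  calc ‖paraSeries c k‖ * (s : ℝ) ^ k ≤ (M * L ^ k * ‖c k‖) * (s : ℝ) ^ k := by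
        gcongr
        exact norm_paraSeries_le c k
    _ = M * (‖c k‖ * (L * s) ^ k) := by ring
    _ ≤ M * (‖c k‖ * (r : ℝ) ^ k) := by
        gcongr
    _ ≤ M * C := by gcongr; exact hc k

theorem contDiffAt_upper {x : Para m} (hx : imNormSq x ≠ 0) (n : WithTop ℕ∞) :
    ContDiffAt ℝ n (upper : Para m → ℂ) x := by
  have h : (upper : Para m → ℂ) = fun x => Complex.equivRealProdCLM.symm (x 0, √(imNormSq x)) := by
    ext x
    rfl
  have h₁ : ContDiff ℝ n (imNormSq : Para m → ℝ) := by
    unfold imNormSq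
    fun_prop
  rw [h]
  refine Complex.equivRealProdCLM.symm.contDiff.contDiffAt.comp x ?_
  exact ContDiffAt.prodMk (by fun_prop) (h₁.contDiffAt.sqrt hx)

/-- The slice function on the paravectors induced by the stem function `F`. -/
def induce (F : ℂ → StemSpace m) (x : Para m) : Cl m :=
  reL m (F (upper x)) + (√(imNormSq x))⁻¹ • (imCl x * imL m (F (upper x)))

theorem induce_phi {D : Set ℂ} {F : ℂ → StemSpace m} (hs : IsStemOn D F) {I : Para m}
    (hI : I ∈ imUnits m) {z : ℂ} (hz : z ∈ D) : induce F (phi I z) = sliceMap I (F z) := by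
  have key : ∀ J ∈ imUnits m, ∀ w : ℂ, 0 < w.im → induce F (phi J w) = sliceMap J (F w) := by
    intro J hJ w hw
    have hu : upper (phi J w) = w := by rw [upper_phi hJ, abs_of_pos hw]
    rw [induce, hu, imNormSq_phi hJ, Real.sqrt_sq hw.le, imCl_phi, smul_mul_assoc, smul_smul,
      inv_mul_cancel₀ hw.ne', one_smul, sliceMap_apply, toCl_eq_imCl hJ]
  rcases lt_trichotomy z.im 0 with h | h | h
  · rw [← phi_neg_conj, key (-I) (neg_mem_imUnits hI) _ (by simpa using h), hs z hz,
      sliceMap_neg, star_star]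
  -- At real `z`, `imCl` vanishes, so the second term of `induce` drops out whatever `0⁻¹` is, and
  -- the stem condition makes `F z` real.
  · have hc : (starRingEnd ℂ) z = z := Complex.conj_eq_iff_im.2 h
    have hst : star (F z) = F z := by rw [← hs z hz, hc]
    have hu : upper (phi I z) = z := by
      rw [upper_phi hI]
      apply Complex.ext <;> simp [h]
    rw [sliceMap_eq_reL_of_star_eq I hst, induce, hu, imNormSq_phi hI, h]
    simp
  · exact key I hI z h

/-- Functions induced by holomorphic stem functions are real analytic, across the real axis too. -/
theorem analyticOnNhd_of_stem (hm : 1 ≤ m) {Ω : Set (Para m)} (ho : IsOpen Ω)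
    (hΩ : IsCircular Ω) {F : ℂ → StemSpace m} (hs : IsStemOn (planar Ω) F)
    (hF : DifferentiableOn ℂ F (planar Ω)) {f : Para m → Cl m}
    (hf : ∀ I ∈ imUnits m, ∀ z ∈ planar Ω, f (phi I z) = sliceMap I (F z)) :
    AnalyticOnNhd ℝ f Ω := by
  have hD := isOpen_planar hm hΩ ho
  intro x hx
  have hxD := upper_mem_planar hm hx
  by_cases h0 : imNormSq x = 0
  -- `upper` contains a square root that degenerates on the axis, so real points need the power
  -- series in `x - x₀`.
  · have hxr := upper_of_mem_realAxis ((imNormSq_eq_zero_iff x).1 h0)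
    obtain ⟨r, hr, hrD, c, C, hC, hsum⟩ := exists_hasSum_sliceMap hD hF hs (hxr ▸ hxD)
    have hrad := radius_paraSeries_pos hr hC
    refine HasFPowerSeriesAt.analyticAt (p := paraSeries c)
      ⟨min (paraSeries c).radius r, min_le_left _ _, lt_min hrad (ENNReal.coe_pos.2 hr), ?_⟩
    intro y hy
    obtain ⟨I, hI, hyI⟩ := exists_eq_phi_upper hm y
    set z := upper y
    have hyr : ‖y‖ < r := by
      have := (Metric.mem_eball.1 hy).trans_le (min_le_right _ _)
      rw [edist_zero_right, enorm_eq_nnnorm, ENNReal.coe_lt_coe] at this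
      exact_mod_cast this
    have hz : ‖z‖ < r := by rwa [← norm_phi hI, ← hyI]
    have hxI : x = phi I (x 0 : ℝ) := by
      obtain ⟨J, hJ, hxJ⟩ := exists_eq_phi_upper hm x
      rw [hxr, phi_ofReal J I] at hxJ
      exact hxJ
    have hfx : f (x + y) = sliceMap I (F ((x 0 : ℝ) + z)) := by
      have hmem : ((x 0 : ℝ) : ℂ) + z ∈ planar Ω := hrD (by simpa using hz)
      rw [← hf I hI _ hmem, phi_add, ← hxI, ← hyI]
    rw [hfx]
    simp only [paraSeries_apply]
    rw [hyI]
    exact hsum I hI z hz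
  -- In `WithTop ℕ∞` the order `⊤` means analytic, not merely smooth.
  · have h₁ : ContDiffAt ℝ ⊤ (induce F) x := by
      have hu := contDiffAt_upper h0 ⊤
      have hFu : ContDiffAt ℝ ⊤ (fun x => F (upper x)) x :=
        ContDiffAt.comp x (((hF.contDiffOn hD).contDiffAt (hD.mem_nhds hxD)).restrict_scalars ℝ) hu
      have hn : ContDiff ℝ ⊤ (imNormSq : Para m → ℝ) := by
        unfold imNormSq
        fun_prop
      have hsq : √(imNormSq x) ≠ 0 :=
        (Real.sqrt_pos.2 (lt_of_le_of_ne (imNormSq_nonneg x) (Ne.symm h0))).ne'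
      have hi : ContDiffAt ℝ ⊤ (fun x : Para m => mulL m (imClL m x)) x :=
        ((mulL m) ∘L (imClL m)).contDiff.contDiffAt
      have hmul := hi.clm_apply ((imL m).contDiff.contDiffAt.comp x hFu)
      have := ((reL m).contDiff.contDiffAt.comp x hFu).add
        (((hn.contDiffAt.sqrt h0).inv hsq).smul hmul)
      simp only [mulL_apply, imClL_apply] at this
      exact this
    refine h₁.analyticAt.congr ?_
    filter_upwards [ho.mem_nhds hx] with y hy
    obtain ⟨I, hI, hyI⟩ := exists_eq_phi_upper hm y
    rw [hyI, hf I hI _ (upper_mem_planar hm hy), induce_phi hs hI (upper_mem_planar hm hy)]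

theorem mem_sliceMonogenic_of_stem (hm : 1 ≤ m) {Ω : Set (Para m)} (ho : IsOpen Ω)
    (hΩ : IsCircular Ω) {F : ℂ → StemSpace m} (hs : IsStemOn (planar Ω) F)
    (hF : DifferentiableOn ℂ F (planar Ω)) {f : Para m → Cl m}
    (hf : ∀ I ∈ imUnits m, ∀ z ∈ planar Ω, f (phi I z) = sliceMap I (F z)) :
    f ∈ sliceMonogenic Ω := by
  refine ⟨(analyticOnNhd_of_stem hm ho hΩ hs hF hf).contDiffOn ho.uniqueDiffOn,
    fun I hI z hz => ?_⟩
  have hD := isOpen_planar hm hΩ ho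
  have hFz := hF.differentiableAt (hD.mem_nhds hz)
  rw [dbar_eq_sliceMap hI hD (hf I hI) hz (hFz.restrictScalars ℝ),
    (dbarC_eq_zero_iff (hFz.restrictScalars ℝ)).2 hFz, map_zero]

/-! ### Comparison of `ϑ̄_m` with the planar Cauchy–Riemann operator -/

/-- At `x = α + Iβ`, `Im(x)/|Im(x)|²` is `I/β` and the Euler-type sum is `β` times the derivative
along `I`; the factors `β` cancel. -/
theorem thetaBar_phi {f : Para m → Cl m} {I : Para m} (hI : I ∈ imUnits m) {z : ℂ}
    (hz : z.im ≠ 0) (hf : DifferentiableAt ℝ f (phi I z)) :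
    thetaBar f (phi I z) = dbar I f z := by
  have hd : fderiv ℝ (fun w => f (phi I w)) z = (fderiv ℝ f (phi I z)).comp (phiL I) :=
    (HasFDerivAt.comp z (f := phiL I) hf.hasFDerivAt (phiL I).hasFDerivAt).fderiv
  have h1 : phi I 1 = EuclideanSpace.single 0 1 := by simp [phi]
  have hI' : phi I Complex.I = I := by simp [phi]
  have hsum : ∑ j : Fin m, (phi I z) j.succ • partialDeriv j.succ f (phi I z) =
      z.im • fderiv ℝ f (phi I z) I := by
    simp only [partialDeriv, ← map_smul, ← map_sum]
    congr 1
    ext k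
    simp only [PiLp.smul_apply, WithLp.ofLp_sum, Finset.sum_apply, PiLp.single_apply,
      phi_succ_coord, smul_eq_mul]
    refine Fin.cases ?_ (fun k => ?_) k
    · simp [hI.1, (Fin.succ_ne_zero _).symm]
    · simp [Fin.succ_inj]
  rw [thetaBar, dbar, hd, hsum, imNormSq_phi hI, imCl_phi, partialDeriv, toCl_eq_imCl hI]
  simp only [ContinuousLinearMap.comp_apply, phiL_apply, h1, hI', smul_smul, smul_mul_assoc,
    mul_smul_comm]
  rw [show z.im * ((z.im ^ 2)⁻¹ * z.im) = 1 by field_simp, one_smul]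

theorem contDiffOn_thetaBar {U : Set (Para m)} (hU : IsOpen U) (hr : Disjoint U (realAxis m))
    {n : ℕ} {f : Para m → Cl m} (hf : ContDiffOn ℝ (n + 1 : ℕ) f U) :
    ContDiffOn ℝ n (thetaBar f) U := by
  have hf' : ContDiffOn ℝ n (fderiv ℝ f) U := hf.fderiv_of_isOpen hU (by norm_cast)
  have hp : ∀ h, ContDiffOn ℝ n (partialDeriv h f) U := fun h => hf'.clm_apply contDiffOn_const
  have hn : ContDiff ℝ n (imNormSq : Para m → ℝ) := by
    unfold imNormSq
    fun_prop
  have hi : ContDiffOn ℝ n (fun x => (imNormSq x)⁻¹ • imCl x) U := by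
    refine (hn.contDiffOn.inv fun x hx h0 => ?_).smul ?_
    · exact Set.disjoint_left.1 hr hx ((imNormSq_eq_zero_iff x).1 h0)
    · exact (imClL m).contDiff.contDiffOn.congr fun x _ => (imClL_apply x).symm
  have hs : ContDiffOn ℝ n (fun x : Para m => ∑ j : Fin m, x j.succ • partialDeriv j.succ f x) U :=
    ContDiffOn.sum fun j _ => ContDiffOn.smul
      (EuclideanSpace.proj j.succ : Para m →L[ℝ] ℝ).contDiff.contDiffOn (hp j.succ)
  have hm := ((mulL m).contDiff.comp_contDiffOn hi).clm_apply hs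
  exact ((hp 0).add hm).const_smul (1 / 2 : ℝ)

/-- One step replaces the pair `(f, F)` by `(ϑ̄_m f, ∂̄F)`, which satisfies the same hypotheses with
one derivative less. They are imposed off the axis only, where `ϑ̄_m` is controlled. -/
theorem thetaBar_iterate_phi {Ω : Set (Para m)} (ho : IsOpen Ω) (hΩ : IsCircular Ω)
    (hm : 1 ≤ m) (n : ℕ) {f : Para m → Cl m} {F : ℂ → StemSpace m}
    (hf : ContDiffOn ℝ n f (Ω \ realAxis m))
    (hF : ContDiffOn ℝ n F (planar Ω ∩ {z | z.im ≠ 0}))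
    (h : ∀ I ∈ imUnits m, ∀ z ∈ planar Ω ∩ {z | z.im ≠ 0}, f (phi I z) = sliceMap I (F z)) :
    ∀ I ∈ imUnits m, ∀ z ∈ planar Ω ∩ {z | z.im ≠ 0},
      (thetaBar^[n] f) (phi I z) = sliceMap I ((dbarC^[n] F) z) := by
  have hD : IsOpen (planar Ω ∩ {z : ℂ | z.im ≠ 0}) :=
    (isOpen_planar hm hΩ ho).inter (isOpen_ne_fun Complex.continuous_im continuous_const)
  have hU : IsOpen (Ω \ realAxis m) := by
    have : Ω \ realAxis m = Ω ∩ {x | imNormSq x ≠ 0} := by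
      ext x
      simp [imNormSq_eq_zero_iff]
    rw [this]
    exact ho.inter (isOpen_ne_fun continuous_imNormSq continuous_const)
  induction n generalizing f F with
  | zero => exact h
  | succ n ih =>
    refine ih (contDiffOn_thetaBar hU Set.disjoint_sdiff_left hf) (contDiffOn_dbarC hD hF)
      fun I hI z hz => ?_
    have hmem : phi I z ∈ Ω \ realAxis m :=
      ⟨phi_mem hΩ hI hz.1, fun hr => hz.2 ((phi_mem_realAxis_iff hI z).1 hr)⟩
    rw [thetaBar_phi hI hz.2 ((hf.contDiffAt (hU.mem_nhds hmem)).differentiableAt (by simp))]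
    exact dbar_eq_sliceMap hI hD (h I hI) hz
      ((hF.contDiffAt (hD.mem_nhds hz)).differentiableAt (by simp))

/-! ### Global slice polymonogenic functions and the two inclusions -/

theorem sliceMap_conjPolySum {I : Para m} (hI : I ∈ imUnits m) (n : ℕ) (G : ℕ → ℂ → StemSpace m)
    (z : ℂ) : sliceMap I (conjPolySum n G z) =
      ∑ h : Fin n, conjCl (phi I z) ^ (h : ℕ) * sliceMap I (G h z) := by
  rw [conjPolySum, map_sum, Finset.sum_range]
  simp only [sliceMap_pow_smul hI, conjCl_phi hI]

theorem isStemOn_conjPolySum {D : Set ℂ} (n : ℕ) {G : ℕ → ℂ → StemSpace m}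
    (hG : ∀ h, IsStemOn D (G h)) : IsStemOn D (conjPolySum n G) := by
  intro z hz
  rw [conjPolySum, conjPolySum, star_sum]
  refine Finset.sum_congr rfl fun h _ => ?_
  rw [hG h z hz, star_smul]
  simp

theorem exists_stem_of_mem_globalSlicePolymonogenic (hm : 1 ≤ m) {Ω : Set (Para m)}
    (ho : IsOpen Ω) (hΩ : IsCircular Ω) (hc : IsConnected Ω)
    (hr : (Ω ∩ realAxis m).Nonempty) {n : ℕ} {f : Para m → Cl m}
    (hf : f ∈ globalSlicePolymonogenic n Ω) :
    ∃ G : ℕ → ℂ → StemSpace m, (∀ h, IsStemOn (planar Ω) (G h)) ∧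
      (∀ h, DifferentiableOn ℂ (G h) (planar Ω)) ∧
      ∀ I ∈ imUnits m, ∀ z ∈ planar Ω, f (phi I z) = sliceMap I (conjPolySum n G z) := by
  obtain ⟨g, hg, hfg⟩ := hf
  choose F hFs hFd hFg using fun h =>
    exists_stem_of_mem_sliceMonogenic hm ho hΩ hc hr (hg h)
  refine ⟨fun k => if h : k < n then F ⟨k, h⟩ else 0, fun k => ?_, fun k => ?_,
    fun I hI z hz => ?_⟩
  · by_cases h : k < n
    · simpa only [h, dif_pos] using hFs ⟨k, h⟩
    · simp only [h, dif_neg, not_false_eq_true]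
      intro z _
      simp
  · by_cases h : k < n
    · simpa only [h, dif_pos] using hFd ⟨k, h⟩
    · simp only [h, dif_neg, not_false_eq_true]
      exact differentiableOn_const 0
  · rw [hfg _ (phi_mem hΩ hI hz), sliceMap_conjPolySum hI]
    refine Finset.sum_congr rfl fun h _ => ?_
    rw [hFg h I hI z hz, dif_pos h.2]

theorem analyticOnNhd_of_mem_globalSlicePolymonogenic (hm : 1 ≤ m) {Ω : Set (Para m)}
    (ho : IsOpen Ω) (hΩ : IsCircular Ω) (hc : IsConnected Ω)
    (hr : (Ω ∩ realAxis m).Nonempty) {n : ℕ} {f : Para m → Cl m}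
    (hf : f ∈ globalSlicePolymonogenic n Ω) : AnalyticOnNhd ℝ f Ω := by
  obtain ⟨g, hg, hfg⟩ := hf
  have hga : ∀ h, AnalyticOnNhd ℝ (g h) Ω := fun h => by
    obtain ⟨F, hFs, hFd, hFg⟩ := exists_stem_of_mem_sliceMonogenic hm ho hΩ hc hr (hg h)
    exact analyticOnNhd_of_stem hm ho hΩ hFs hFd hFg
  have hmul : ∀ (k : ℕ) (u : Para m → Cl m), AnalyticOnNhd ℝ u Ω →
      AnalyticOnNhd ℝ (fun x => conjCl x ^ k * u x) Ω := by
    intro k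
    -- One factor `x̄` at a time, by the bilinear map `mulL`, since `ℝ_m` carries no normed algebra
    -- structure here.
    induction k with
    | zero => intro u hu; simpa using hu
    | succ k ih =>
      intro u hu
      have h₁ : AnalyticOnNhd ℝ (fun x => mulL m (conjClL m x) (u x)) Ω := fun x hx =>
        ((((mulL m) ∘L (conjClL m)).contDiff (n := ⊤)).contDiffAt.clm_apply
          (hu x hx).contDiffAt).analyticAt
      simpa only [mulL_apply, conjClL_apply, pow_succ, mul_assoc] using ih _ h₁
  have hsum : AnalyticOnNhd ℝ (fun x => ∑ h : Fin n, conjCl x ^ (h : ℕ) * g h x) Ω :=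
    Finset.univ.analyticOnNhd_fun_sum fun h _ => hmul h _ (hga h)
  exact hsum.congr ho fun x hx => (hfg x hx).symm

theorem mem_sliceFunctions_of_stem {Ω : Set (Para m)} {n : ℕ} {f : Para m → Cl m}
    {F : ℂ → StemSpace m} (hs : IsStemOn (planar Ω) F) (hF : ContDiffOn ℝ n F (planar Ω))
    (hf : ∀ I ∈ imUnits m, ∀ z ∈ planar Ω, f (phi I z) = sliceMap I (F z)) :
    f ∈ sliceFunctions n Ω :=
  ⟨fun z => reL m (F z), fun z => imL m (F z),
    fun z hz => ⟨by simp only [hs z hz, reL_star], by simp only [hs z hz, imL_star]⟩,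
    (reL m).contDiff.comp_contDiffOn hF, (imL m).contDiff.comp_contDiffOn hF,
    fun z hz I hI => hf I hI z hz⟩

theorem exists_stem_of_mem_sliceFunctions {Ω : Set (Para m)} {n : ℕ} {f : Para m → Cl m}
    (hf : f ∈ sliceFunctions n Ω) :
    ∃ F : ℂ → StemSpace m, IsStemOn (planar Ω) F ∧ ContDiffOn ℝ n F (planar Ω) ∧
      ∀ I ∈ imUnits m, ∀ z ∈ planar Ω, f (phi I z) = sliceMap I (F z) := by
  obtain ⟨F₁, F₂, hs, h₁, h₂, h⟩ := hf
  refine ⟨fun z => complexify m (F₁ z) + Complex.I • complexify m (F₂ z), fun z hz => ?_, ?_,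
    fun I hI z hz => ?_⟩
  · dsimp only
    rw [(hs z hz).1, (hs z hz).2, star_add, star_smul, star_complexify, star_complexify]
    simp
  · exact ((complexify m).contDiff.comp_contDiffOn h₁).add
      (((complexify m).contDiff.comp_contDiffOn h₂).const_smul Complex.I)
  · rw [h z hz I hI, sliceMap_apply]
    simp

theorem continuousOn_dbarC_iterate {E : Type*} [NormedAddCommGroup E] [NormedSpace ℂ E]
    {D : Set ℂ} (hD : IsOpen D) (n : ℕ) {F : ℂ → E} (hF : ContDiffOn ℝ n F D) :
    ContinuousOn (dbarC^[n] F) D := by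
  induction n generalizing F with
  | zero => exact hF.continuousOn
  | succ n ih => exact ih (contDiffOn_dbarC hD hF)

theorem subset_closure_inter_im_ne_zero {D : Set ℂ} (hD : IsOpen D) :
    D ⊆ closure (D ∩ {z | z.im ≠ 0}) :=
  Dense.open_subset_closure_inter
    (Dense.preimage (dense_compl_singleton (0 : ℝ)) Complex.isOpenMap_im) hD

theorem mem_globalSlicePolymonogenic_of_thetaBar (hm : 1 ≤ m) {Ω : Set (Para m)}
    (ho : IsOpen Ω) (hΩ : IsCircular Ω) {n : ℕ} {f : Para m → Cl m}
    (hf : f ∈ sliceFunctions n Ω) (hk : f ∈ kerThetaBarPow n (Ω \ realAxis m)) :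
    f ∈ globalSlicePolymonogenic n Ω := by
  have hD := isOpen_planar hm hΩ ho
  obtain ⟨F, hFs, hFc, hFf⟩ := exists_stem_of_mem_sliceFunctions hf
  obtain ⟨I, hI⟩ := imUnits_nonempty hm
  have hit := thetaBar_iterate_phi ho hΩ hm n hk.1 (hFc.mono Set.inter_subset_left)
    fun J hJ z hz => hFf J hJ z hz.1
  have hoff : Set.EqOn (dbarC^[n] F) 0 (planar Ω ∩ {z | z.im ≠ 0}) := by
    intro z hz
    have h : ∀ J ∈ imUnits m, sliceMap J ((dbarC^[n] F) z) = 0 := fun J hJ => by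
      rw [← hit J hJ z hz]
      exact hk.2 _ ⟨phi_mem hΩ hJ hz.1, fun hr => hz.2 ((phi_mem_realAxis_iff hJ z).1 hr)⟩
    exact eq_zero_of_sliceMap hI (h I hI) (h (-I) (neg_mem_imUnits hI))
  -- The kernel condition says nothing on the axis; there the `Cⁿ` regularity of the stem function
  -- is what extends the equation.
  have hzero : Set.EqOn (dbarC^[n] F) 0 (planar Ω) :=
    hoff.of_subset_closure (continuousOn_dbarC_iterate hD n hFc) continuousOn_const
      Set.inter_subset_left (subset_closure_inter_im_ne_zero hD)
  obtain ⟨G, hG, hFG⟩ := exists_eq_conjPolySum hD n hFc hzero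
  have hFG' := eqOn_conjPolySum_symmetrize (fun _ => conj_mem_planar) hFs hFG
  refine ⟨fun h => induce (symmetrize (G h)), fun h => ?_, fun x hx => ?_⟩
  · exact mem_sliceMonogenic_of_stem hm ho hΩ (isStemOn_symmetrize _ _)
      (differentiableOn_symmetrize hD (fun _ => conj_mem_planar) (hG h))
      fun J hJ z hz => induce_phi (isStemOn_symmetrize (planar Ω) _) hJ hz
  · obtain ⟨J, hJ, hxJ⟩ := exists_eq_phi_upper hm x
    have hz := upper_mem_planar hm hx
    rw [hxJ, hFf J hJ _ hz, hFG' hz, sliceMap_conjPolySum hJ]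
    refine Finset.sum_congr rfl fun h _ => ?_
    dsimp only
    rw [induce_phi (isStemOn_symmetrize (planar Ω) _) hJ hz]

end SliceMonogenic

end

theorem mainTheorem10 (m : ℕ) (hm : 2 ≤ m) (Ω : Set (SliceMonogenic.Para m))
    (hopen : IsOpen Ω) (hconn : IsConnected Ω) (hcirc : SliceMonogenic.IsCircular Ω)
    (hreal : (Ω ∩ SliceMonogenic.realAxis m).Nonempty) (n : ℕ) (hn : 1 ≤ n) :
    SliceMonogenic.globalSlicePolymonogenic n Ω =
        {f | f ∈ SliceMonogenic.sliceFunctions n Ω ∧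
          f ∈ SliceMonogenic.kerThetaBarPow n (Ω \ SliceMonogenic.realAxis m)} ∧
      SliceMonogenic.globalSlicePolymonogenic n Ω ⊆ {f | AnalyticOnNhd ℝ f Ω} := by
  have hm1 : 1 ≤ m := one_le_two.trans hm
  have han : SliceMonogenic.globalSlicePolymonogenic n Ω ⊆ {f | AnalyticOnNhd ℝ f Ω} :=
    fun f hf => SliceMonogenic.analyticOnNhd_of_mem_globalSlicePolymonogenic hm1 hopen hcirc hconn
      hreal hf
  refine ⟨Set.Subset.antisymm (fun f hf => ?_) fun f hf =>
    SliceMonogenic.mem_globalSlicePolymonogenic_of_thetaBar hm1 hopen hcirc hf.1 hf.2, han⟩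
  have hD := SliceMonogenic.isOpen_planar hm1 hcirc hopen
  obtain ⟨G, hGs, hGd, hfG⟩ := SliceMonogenic.exists_stem_of_mem_globalSlicePolymonogenic hm1
    hopen hcirc hconn hreal hf
  have hC := SliceMonogenic.contDiffOn_conjPolySum hD n hGd n
  have hfC : ContDiffOn ℝ n f (Ω \ SliceMonogenic.realAxis m) :=
    ((han hf).contDiffOn hopen.uniqueDiffOn).mono Set.sdiff_subset
  refine ⟨SliceMonogenic.mem_sliceFunctions_of_stem
    (SliceMonogenic.isStemOn_conjPolySum n hGs) hC hfG, hfC, fun x hx => ?_⟩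
  obtain ⟨I, hI, hxI⟩ := SliceMonogenic.exists_eq_phi_upper hm1 x
  have hz := SliceMonogenic.upper_mem_planar hm1 hx.1
  have him : (SliceMonogenic.upper x).im ≠ 0 := fun h0 =>
    hx.2 (hxI ▸ (SliceMonogenic.phi_mem_realAxis_iff hI _).2 h0)
  -- Each `∂̄` lowers the degree in `z̄` by one, so `n` of them annihilate a stem function of degree
  -- less than `n`.
  rw [hxI, SliceMonogenic.thetaBar_iterate_phi hopen hcirc hm1 n hfC (hC.mono Set.inter_subset_left)
    (fun J hJ w hw => hfG J hJ w hw.1) I hI _ ⟨hz, him⟩,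
    SliceMonogenic.dbarC_iterate_conjPolySum hD n hGd _ hz, map_zero]
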